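/- Let $X$ be a finite totally ordered set, let $X^*$ be the free monoid on $X$, ordered lexicographically, and let $L$ be the set of Lyndon words, i.e. the nonempty words that are not of the form $v^r$ with $r\ge 2$ and that are minimal among their cyclic rearrangements. Every word $w$ has a unique factorization $w=l_1l_2\cdots l_n$ with $l_i\in L$ and $l_1\ge l_2\ge\cdots\ge l_n$. Let $[l]$ $(l\in L)$ be distinct commuting variables, let $\mathcal B=(b(x,x'))_{x,x'\in X}$ be a matrix of distinct commuting variables, and consider the $\mathbf Z$-algebras of formal power series in the variables $[l]$ and in the variables $b(x,x')$, with coefficientwise convergence. For $w=x_1x_2\cdots x_m\in X^*$ put $$\beta_{\mathrm{circ}}(w)=b(x_1,x_2)b(x_2,x_3)\cdots b(x_{m-1},x_m)b(x_m,x_1),$$ $$\beta_{\mathrm{dec}}(w)=\beta_{\mathrm{circ}}(l_1)\cdots\beta_{\mathrm{circ}}(l_n),\qquad \beta_{\mathrm{vert}}(w)=b(\tilde x_1,x_1)\cdots b(\tilde x_m,x_m),$$ where $(l_1,\dots,l_n)$ is the nonincreasing Lyndon factorization of $w$ and $\tilde x_1\cdots\tilde x_m$ is the nondecreasing rearrangement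 of $w$; all three are $1$ on the empty word. Let $\beta$ be the continuous homomorphism of $\mathbf Z$-algebras with $\beta([l])=\beta_{\mathrm{circ}}(l)$ for all $l\in L$, and let $\Lambda=\prod_{l\in L}(1-[l])$. Then the product $\Lambda$ converges, $\Lambda$ and $\det(I-\mathcal B)$ are invertible power series, the families $(\beta_{\mathrm{dec}}(w))_{w\in X^*}$ and $(\beta_{\mathrm{vert}}(w))_{w\in X^*}$ are summable, and $$\beta(\Lambda^{-1})=\sum_{w\in X^*}\beta_{\mathrm{dec}}(w),\qquad \sum_{w\in X^*}\beta_{\mathrm{dec}}(w)=\sum_{w\in X^*}\beta_{\mathrm{vert}}(w),$$ $$\sum_{w\in X^*}\beta_{\mathrm{vert}}(w)=\bigl(\det(I-\mathcal B)\bigr)^{-1},\qquad \beta(\Lambda)=\det(I-\mathcal B).$$ Moreover the product $\prod_{l\in L}\bigl(1-\beta_{\mathrm{circ}}(l)\bigr)$ converges, and its value is the polynomial $\det(I-\mathcal B)$. -/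

import Mathlib

open scoped MvPowerSeries.WithPiTopology

noncomputable section

namespace Lyndon

/-! ### Lyndon words -/

section Words

variable {X : Type*}

/-- A word is prime if it is not a power `v ^ r` of another word with `r ≥ 2`. -/
def IsPrimeWord (w : List X) : Prop :=
  ∀ (v : List X) (r : ℕ), 2 ≤ r → w ≠ (List.replicate r v).flatten

theorem commute_words (n : ℕ) : ∀ u v : List X, u.length + v.length ≤ n → u ++ v = v ++ u →
    ∃ (z : List X) (p q : ℕ), u = (List.replicate p z).flatten ∧
      v = (List.replicate q z).flatten := by
  induction n with
  | zero =>
    intro u v hn _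
    have hu : u = [] := List.length_eq_zero_iff.1 (by omega)
    have hv : v = [] := List.length_eq_zero_iff.1 (by omega)
    exact ⟨[], 0, 0, by simp [hu], by simp [hv]⟩
  | succ n ih =>
    have key : ∀ u v : List X, u ≠ [] → u.length + v.length ≤ n + 1 → u.length ≤ v.length →
        u ++ v = v ++ u → ∃ (z : List X) (p q : ℕ), u = (List.replicate p z).flatten ∧
          v = (List.replicate q z).flatten := by
      intro u v hu hn hl h
      obtain ⟨t, rfl⟩ : u <+: v :=
        List.prefix_of_prefix_length_le (h ▸ List.prefix_append u v) (List.prefix_append v u) hl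
      rw [List.append_assoc] at h
      have h' := List.append_cancel_left h
      have hpos := List.length_pos_iff.2 hu
      rw [List.length_append] at hn
      obtain ⟨z, p, q, hp, hq⟩ := ih u t (by omega) h'
      refine ⟨z, p, p + q, hp, ?_⟩
      rw [List.replicate_add, List.flatten_append, ← hp, ← hq]
    intro u v hn h
    by_cases hu : u = []
    · exact ⟨v, 0, 1, by simp [hu], by simp⟩
    by_cases hv : v = []
    · exact ⟨u, 1, 0, by simp, by simp [hv]⟩
    rcases le_total u.length v.length with hl | hl
    · exact key u v hu hn hl h
    · obtain ⟨z, p, q, hp, hq⟩ := key v u hv (by omega) hl h.symm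
      exact ⟨z, q, p, hq, hp⟩

variable [LinearOrder X]

/-- Lyndon words: nonempty prime words that are lexicographically minimal among their
cyclic rearrangements (`List X` carries the lexicographic order of `X`). -/
def IsLyndon (w : List X) : Prop :=
  w ≠ [] ∧ IsPrimeWord w ∧ ∀ v : List X, w ~r v → w ≤ v

/-- `ls = [l₁, …, lₙ]` is the factorization `w = l₁ l₂ ⋯ lₙ` into Lyndon words with
`l₁ ≥ l₂ ≥ ⋯ ≥ lₙ`. -/
def IsLyndonFactorization (w : List X) (ls : List (List X)) : Prop :=
  (∀ l ∈ ls, IsLyndon l) ∧ ls.Pairwise (· ≥ ·) ∧ ls.flatten = w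

theorem append_lt_append_of_not_prefix {u v : List X} (h : u < v) (hp : ¬ u <+: v)
    (s t : List X) : u ++ s < v ++ t := by
  induction u generalizing v with
  | nil => exact (hp List.nil_prefix).elim
  | cons a u ih =>
    cases v with
    | nil => exact (List.not_lt_nil _ h).elim
    | cons b v =>
      rw [List.cons_append, List.cons_append, List.cons_lt_cons_iff]
      rcases List.cons_lt_cons_iff.1 h with h' | ⟨rfl, h'⟩
      · exact Or.inl h'
      · exact Or.inr ⟨rfl, ih h' fun hp' => hp ((List.prefix_cons_inj a).2 hp')⟩

theorem append_left_lt_iff (s : List X) {u v : List X} : s ++ u < s ++ v ↔ u < v := by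
  induction s with
  | nil => rfl
  | cons a s ih => simpa using ih

theorem lt_append_self (u : List X) {t : List X} (ht : t ≠ []) : u < u ++ t := by
  cases t with
  | nil => exact (ht rfl).elim
  | cons a t => simpa using (append_left_lt_iff u (u := []) (v := a :: t)).2 (List.nil_lt_cons a t)

theorem le_append_self (u t : List X) : u ≤ u ++ t := by
  by_cases ht : t = []
  · simp [ht]
  · exact (lt_append_self u ht).le

/-- A Lyndon word is strictly smaller than each of its proper nonempty suffixes. -/
theorem IsLyndon.lt_suffix {u v : List X} (h : IsLyndon (u ++ v)) (hu : u ≠ []) (hv : v ≠ []) :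
    u ++ v < v := by
  obtain ⟨-, hprime, hmin⟩ := h
  have hrot : u ++ v < v ++ u := by
    refine lt_of_le_of_ne (hmin _ List.isRotated_append) fun heq => ?_
    obtain ⟨z, p, q, hp, hq⟩ := commute_words _ u v le_rfl heq
    have hp0 : p ≠ 0 := by rintro rfl; simp at hp; exact hu hp
    have hq0 : q ≠ 0 := by rintro rfl; simp at hq; exact hv hq
    refine hprime z (p + q) (by omega) ?_
    rw [List.replicate_add, List.flatten_append, ← hp, ← hq]
  by_contra hcon
  have hlt : v < u ++ v := by
    refine lt_of_le_of_ne (not_lt.1 hcon) fun heq => hu ?_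
    simpa using congrArg List.length heq
  by_cases hpre : v <+: u ++ v
  · obtain ⟨t, ht⟩ := hpre
    have hlen : t.length = u.length := by
      have := congrArg List.length ht
      simp only [List.length_append] at this
      omega
    have h1 : t < u := by
      rw [← ht] at hrot
      exact (append_left_lt_iff v).1 hrot
    have h2 : u ++ v ≤ t ++ v := hmin _ (ht ▸ List.isRotated_append)
    have h3 : ¬ t <+: u := fun hp => h1.ne (hp.eq_of_length hlen)
    exact absurd (append_lt_append_of_not_prefix h1 h3 v v) (not_lt.2 h2)
  · have := append_lt_append_of_not_prefix hlt hpre u []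
    rw [List.append_nil] at this
    exact absurd this (not_lt.2 hrot.le)

theorem IsLyndon.le_suffix {l s : List X} (h : IsLyndon l) (hs : s <:+ l) (hs0 : s ≠ []) :
    l ≤ s := by
  obtain ⟨u, rfl⟩ := hs
  by_cases hu : u = []
  · simp [hu]
  · exact (h.lt_suffix hu hs0).le

/-- A nonempty word that is minimal among its nonempty suffixes is Lyndon. -/
theorem isLyndon_of_le_suffix {l : List X} (h0 : l ≠ [])
    (h : ∀ s, s <:+ l → s ≠ [] → l ≤ s) : IsLyndon l := by
  refine ⟨h0, ?_, ?_⟩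
  · rintro v r hr rfl
    obtain ⟨k, rfl⟩ : ∃ k, r = k + 2 := ⟨r - 2, by omega⟩
    have hv : v ≠ [] := by rintro rfl; simp at h0
    have e : (List.replicate (k + 2) v).flatten = v ++ (List.replicate (k + 1) v).flatten := by
      rw [List.replicate_succ, List.flatten_cons]
    have e' : (List.replicate (k + 2) v).flatten = (List.replicate (k + 1) v).flatten ++ v := by
      rw [List.replicate_succ', List.flatten_append]; simp
    have hle := h v ⟨_, e'.symm⟩ hv
    rw [e] at hle
    refine absurd (lt_append_self v (t := (List.replicate (k + 1) v).flatten) ?_) (not_lt.2 hle)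
    simp [hv]
  · rintro v ⟨n, rfl⟩
    rw [List.rotate_eq_drop_append_take_mod]
    by_cases hd : l.drop (n % l.length) = []
    · have : l.take (n % l.length) = l := by
        conv_rhs => rw [← List.take_append_drop (n % l.length) l, hd, List.append_nil]
      rw [hd, this, List.nil_append]
    · exact (h _ (List.drop_suffix _ _) hd).trans (le_append_self _ _)

theorem exists_min_suffix (w : List X) (hw : w ≠ []) :
    ∃ s, s <:+ w ∧ s ≠ [] ∧ ∀ t, t <:+ w → t ≠ [] → s ≤ t := by
  obtain ⟨s, hs, hmin⟩ := (w.tails.toFinset.filter (· ≠ [])).exists_min_image id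
    ⟨w, by simp [hw]⟩
  simp only [Finset.mem_filter, List.mem_toFinset, List.mem_tails, id] at hs hmin
  exact ⟨s, hs.1, hs.2, fun t ht ht0 => hmin t ⟨ht, ht0⟩⟩

theorem exists_lyndonFactorization (w : List X) : ∃ ls, IsLyndonFactorization w ls := by
  induction hn : w.length using Nat.strong_induction_on generalizing w with
  | _ n ih =>
    by_cases hw : w = []
    · exact ⟨[], by simp, by simp, by simp [hw]⟩
    obtain ⟨s, ⟨w', rfl⟩, hs0, hmin⟩ := exists_min_suffix w hw
    have hpos := List.length_pos_iff.2 hs0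
    rw [List.length_append] at hn
    have hsL : IsLyndon s :=
      isLyndon_of_le_suffix hs0 fun t ht => hmin t (ht.trans (List.suffix_append w' s))
    obtain ⟨ls, hL, hsort, hflat⟩ := ih w'.length (by omega) w' rfl
    have hlast : ∀ ls' l, ls = ls' ++ [l] → s ≤ l := by
      rintro ls' l rfl
      have hlL := hL l (by simp)
      by_contra hcon
      have hlt := not_le.1 hcon
      have hsuf : l ++ s <:+ w' ++ s := by
        rw [← hflat]; simp
      have hle : s ≤ l ++ s := hmin _ hsuf (by simp [hs0])
      by_cases hpre : l <+: s
      · obtain ⟨t, rfl⟩ := hpre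
        have ht0 : t ≠ [] := by
          rintro rfl
          rw [List.append_nil] at hlt
          exact lt_irrefl _ hlt
        have h1 : l ++ t ≤ t := hmin t (by rw [← List.append_assoc]; exact List.suffix_append _ _) ht0
        have h2 : t ≤ l ++ t := not_lt.1 fun h => not_lt.2 hle ((append_left_lt_iff l).2 h)
        have := le_antisymm h1 h2
        have := congrArg List.length this
        rw [List.length_append] at this
        exact hlL.1 (List.length_eq_zero_iff.1 (by omega))
      · have := append_lt_append_of_not_prefix hlt hpre s []
        rw [List.append_nil] at this
        exact absurd this (not_lt.2 hle)
    refine ⟨ls ++ [s], ?_, ?_, by simp [hflat]⟩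
    · intro l hl
      rcases List.mem_append.1 hl with hl | hl
      · exact hL l hl
      · rw [List.mem_singleton.1 hl]; exact hsL
    · rw [List.pairwise_append]
      refine ⟨hsort, List.pairwise_singleton _ _, fun a ha b hb => ?_⟩
      rw [List.mem_singleton.1 hb]
      rcases List.eq_nil_or_concat ls with rfl | ⟨ls', l, hls⟩
      · simp at ha
      rw [List.concat_eq_append] at hls
      have hl := hlast ls' l hls
      subst hls
      rcases List.mem_append.1 ha with ha | ha
      · exact hl.trans ((List.pairwise_append.1 hsort).2.2 a ha l (by simp))
      · rw [List.mem_singleton.1 ha]; exact hl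

theorem IsLyndonFactorization.last_le {w : List X} {ls : List (List X)} {l : List X}
    (h : IsLyndonFactorization w (ls ++ [l])) {s : List X} (hs : s <:+ w) (hs0 : s ≠ []) :
    l ≤ s := by
  obtain ⟨hL, hsort, rfl⟩ := h
  have hge : ∀ a ∈ ls ++ [l], l ≤ a := by
    intro a ha
    rcases List.mem_append.1 ha with ha | ha
    · exact (List.pairwise_append.1 hsort).2.2 a ha l (by simp)
    · rw [List.mem_singleton.1 ha]
  clear hsort
  generalize ls ++ [l] = ms at *
  induction ms with
  | nil => exact (hs0 (List.suffix_nil.1 hs)).elim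
  | cons m ms ih =>
    obtain ⟨u, hu⟩ := hs
    rw [List.flatten_cons] at hu
    have ih' := fun h => ih (fun a ha => hL a (by simp [ha])) h (fun a ha => hge a (by simp [ha]))
    rcases List.append_eq_append_iff.1 hu with ⟨as, h1, h2⟩ | ⟨cs, -, h2⟩
    · by_cases has : as = []
      · subst has
        exact ih' ⟨[], by simpa using h2⟩
      · rw [h2]
        exact (hge m (by simp)).trans <|
          ((hL m (by simp)).le_suffix ⟨u, h1.symm⟩ has).trans (le_append_self _ _)
    · exact ih' ⟨cs, h2.symm⟩

theorem lyndonFactorization_unique {w : List X} {ls ms : List (List X)}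
    (h : IsLyndonFactorization w ls) (h' : IsLyndonFactorization w ms) : ls = ms := by
  induction ls using List.reverseRecOn generalizing w ms with
  | nil =>
    obtain ⟨hL', -, hf'⟩ := h'
    have : w = [] := by rw [← h.2.2]; rfl
    cases ms with
    | nil => rfl
    | cons m ms =>
      rw [this, List.flatten_cons] at hf'
      exact ((hL' m (by simp)).1 (List.append_eq_nil_iff.1 hf').1).elim
  | append_singleton ls l ih =>
    have hl := h.1 l (by simp)
    rcases List.eq_nil_or_concat ms with rfl | ⟨ms', m, hms⟩
    · have e : (ls ++ [l]).flatten = [] := by rw [h.2.2, ← h'.2.2]; rfl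
      simp [hl.1] at e
    rw [List.concat_eq_append] at hms
    subst hms
    have hm := h'.1 m (by simp)
    have e1 : ls.flatten ++ l = w := by rw [← h.2.2]; simp
    have e2 : ms'.flatten ++ m = w := by rw [← h'.2.2]; simp
    have hlm : l = m := le_antisymm (h.last_le ⟨_, e2⟩ hm.1) (h'.last_le ⟨_, e1⟩ hl.1)
    subst hlm
    have e : ls.flatten = ms'.flatten := List.append_cancel_right (e1.trans e2.symm)
    rw [ih (w := ls.flatten) (ms := ms')
      ⟨fun a ha => h.1 a (by simp [ha]), (List.pairwise_append.1 h.2.1).1, rfl⟩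
      ⟨fun a ha => h'.1 a (by simp [ha]), (List.pairwise_append.1 h'.2.1).1, e.symm⟩]

/-- The nonincreasing Lyndon factorization of a word. -/
def lyndonFactorization (w : List X) : List (List X) :=
  (exists_lyndonFactorization w).choose

theorem lyndonFactorization_spec (w : List X) :
    IsLyndonFactorization w (lyndonFactorization w) :=
  (exists_lyndonFactorization w).choose_spec

end Words

/-! ### The algebras of power series and the maps `β` -/

section Series

variable {X : Type*}

/-- The formal power series in the variables `b(x, x')`, with integer coefficients. -/
abbrev BSeries (X : Type*) := MvPowerSeries (X × X) ℤ

/-- The variable `b(x, x')`. -/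
def b (x x' : X) : BSeries X := MvPowerSeries.X (x, x')

/-- `b(x₁, x₂) b(x₂, x₃) ⋯ b(xₘ₋₁, xₘ) b(xₘ, x₁)` for `w = x₁ x₂ ⋯ xₘ`, and `1` for the
empty word. -/
def betaCirc (w : List X) : BSeries X :=
  (List.zipWith b w (w.rotate 1)).prod

theorem prod_zipWith_b (u v : List X) (h : u.length = v.length) :
    ∃ d : (X × X) →₀ ℕ, d.degree = u.length ∧
      (List.zipWith b u v).prod = MvPowerSeries.monomial d (1 : ℤ) := by
  induction u generalizing v with
  | nil => exact ⟨0, by simp, by simp⟩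
  | cons x u ih =>
    cases v with
    | nil => simp at h
    | cons y v =>
      obtain ⟨d, hd, hp⟩ := ih v (by simpa using h)
      refine ⟨Finsupp.single (x, y) 1 + d, by simp [hd, add_comm], ?_⟩
      rw [List.zipWith_cons_cons, List.prod_cons, hp, b, MvPowerSeries.X,
        MvPowerSeries.monomial_mul_monomial, one_mul]

variable [LinearOrder X]

/-- `betaCirc l₁ ⋯ betaCirc lₙ` for the nonincreasing Lyndon factorization `w = l₁ ⋯ lₙ`. -/
def betaDec (w : List X) : BSeries X :=
  ((lyndonFactorization w).map betaCirc).prod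

/-- `b(x̃₁, x₁) ⋯ b(x̃ₘ, xₘ)` where `x̃₁ ⋯ x̃ₘ` is the nondecreasing rearrangement of
`w = x₁ ⋯ xₘ`. -/
def betaVert (w : List X) : BSeries X :=
  (List.zipWith b (w.insertionSort (· ≤ ·)) w).prod

variable (X) in
/-- The formal power series in the variables `[l]`, one for each Lyndon word `l`. -/
abbrev LyndonSeries := MvPowerSeries {l : List X // IsLyndon l} ℤ

/-- The variable `[l]`. -/
def lyndonVar (l : {l : List X // IsLyndon l}) : LyndonSeries X := MvPowerSeries.X l

variable (X) in
/-- `Λ = ∏ (1 - [l])` over all Lyndon words `l`. -/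
def Lam : LyndonSeries X := ∏' l : {l : List X // IsLyndon l}, (1 - lyndonVar l)

variable [Finite X]

theorem hasSubst_betaCirc :
    MvPowerSeries.HasSubst (fun l : {l : List X // IsLyndon l} => betaCirc l.1) where
  const_coeff l := by
    obtain ⟨d, hd, hp⟩ := prod_zipWith_b l.1 (l.1.rotate 1) (by simp)
    have h0 : d ≠ 0 := by
      rintro rfl
      rw [map_zero] at hd
      exact l.2.1 (List.length_eq_zero_iff.1 hd.symm)
    rw [betaCirc, hp, ← MvPowerSeries.coeff_zero_eq_constantCoeff_apply,
      MvPowerSeries.coeff_monomial, if_neg h0.symm]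
    exact IsNilpotent.zero
  coeff_zero e := by
    refine Set.Finite.subset ((List.finite_length_eq X e.degree).preimage
      Subtype.val_injective.injOn) fun l hl => ?_
    obtain ⟨d, hd, hp⟩ := prod_zipWith_b l.1 (l.1.rotate 1) (by simp)
    rw [Set.mem_ofPred_eq, betaCirc, hp, MvPowerSeries.coeff_monomial] at hl
    have : e = d := by
      by_contra hne
      exact hl (if_neg hne)
    simp [this, hd]

variable (X) in
/-- The continuous homomorphism of `ℤ`-algebras with `β([l]) = betaCirc l`. -/
def beta : LyndonSeries X →ₐ[ℤ] BSeries X :=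
  MvPowerSeries.substAlgHom hasSubst_betaCirc

theorem beta_lyndonVar (l : {l : List X // IsLyndon l}) : beta X (lyndonVar l) = betaCirc l.1 :=
  MvPowerSeries.substAlgHom_X _ l

theorem continuous_beta : Continuous (beta X) := by
  rw [beta, MvPowerSeries.coe_substAlgHom]
  exact MvPowerSeries.continuous_subst hasSubst_betaCirc

end Series

end Lyndon

end

/-! By unique factorization, words correspond to finite multisets of Lyndon words, that is, to
monomials in the variables `[l]` (`factorCount_bijective`). The inverse of `Λ` is the sum of all
monomials, so the continuous map `β` sends it to the sum of the `betaDec w`. It remains to see that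
the `betaDec` sum and the `betaVert` sum are both inverse to `det(I - B)`. Uniqueness of inverses
then gives the identities, and applying `β` to the product `Λ` gives the product formula.

Both inversions switch on the rows of `B` one at a time, the rows outside a set `S` being zero;
Cramer's rule (`det_one_sub_mul_of_mulVec_eq_single`) tells how the determinant changes when row `x`
is added. For `betaDec`, `x` is taken smaller than all of `S`: cutting a word at its first `x`
leaves a prefix over `S` and a closed walk at `x`, and the weights multiply, so the sum gains the
factor `1 +` (closed walks at `x`) (`tsum_decWeight_insert`). For `betaVert`, grouping words by
content gives the diagonal coefficients of MacMahon's master theorem, and these satisfy a linear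
system with matrix `I - B` once the source and target contents may differ by one letter
(`det_mul_tsum_formCoeff`). -/

noncomputable section

namespace Lyndon

/-! ### Summability by order -/

section Summability

variable {σ ι : Type*}

theorem le_order_sum {n : ℕ∞} (s : Finset ι) (f : ι → MvPowerSeries σ ℤ)
    (h : ∀ i ∈ s, n ≤ (f i).order) : n ≤ (∑ i ∈ s, f i).order := by
  refine MvPowerSeries.le_order fun d hd => ?_
  rw [map_sum]
  exact Finset.sum_eq_zero fun i hi => MvPowerSeries.coeff_of_lt_order (hd.trans_le (h i hi))

/-- A family of power series is summable if all but finitely many members have order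
at least `n`, for every `n`. -/
theorem summable_of_le_order (deg : ι → ℕ) (hfin : ∀ n, {i | deg i ≤ n}.Finite)
    {f : ι → MvPowerSeries σ ℤ} (h : ∀ i, (deg i : ℕ∞) ≤ (f i).order) : Summable f := by
  rw [MvPowerSeries.WithPiTopology.summable_iff_summable_coeff]
  refine fun d => summable_of_hasFiniteSupport ((hfin d.degree).subset fun i hi => ?_)
  by_contra hcon
  refine hi (MvPowerSeries.coeff_of_lt_order (lt_of_lt_of_le ?_ (h i)))
  simpa using hcon

theorem finite_setOf_card_le [Finite σ] (n : ℕ) : {s : Multiset σ | s.card ≤ n}.Finite := by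
  refine ((List.finite_length_le σ n).image (fun w : List σ => (w : Multiset σ))).subset ?_
  intro s hs
  exact ⟨s.toList, by simpa using hs, by simp⟩

end Summability

/-! ### The inverse of the product of all `1 - X i` -/

section Geometric

variable {σ : Type*}

/-- The sum of all monomials. -/
def sumMonomials (σ : Type*) : MvPowerSeries σ ℤ := fun _ => 1

theorem hasSum_monomial_sumMonomials :
    HasSum (fun d : σ →₀ ℕ => MvPowerSeries.monomial d (1 : ℤ)) (sumMonomials σ) :=
  MvPowerSeries.WithPiTopology.hasSum_of_monomials_self (sumMonomials σ)

theorem summable_prod_neg_X :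
    Summable fun s : Finset σ => ∏ i ∈ s, -(MvPowerSeries.X i : MvPowerSeries σ ℤ) := by
  -- Each product is a signed squarefree monomial with support `s`, so only `s = d.support` can
  -- contribute to the coefficient at `d`.
  have key (s : Finset σ) : ∏ i ∈ s, -(MvPowerSeries.X i : MvPowerSeries σ ℤ) =
      MvPowerSeries.monomial (∑ i ∈ s, Finsupp.single i 1) ((-1) ^ s.card) := by
    classical
    induction s using Finset.induction_on with
    | empty => simp
    | insert a s ha ih =>
      rw [Finset.prod_insert ha, Finset.sum_insert ha, Finset.card_insert_of_notMem ha, ih,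
        MvPowerSeries.X, ← map_neg, MvPowerSeries.monomial_mul_monomial, pow_succ']
  have hsupp (s : Finset σ) : (∑ i ∈ s, Finsupp.single i 1 : σ →₀ ℕ).support = s := by
    classical
    ext j
    simp [Finsupp.finsetSum_apply, Finsupp.single_apply]
  classical
  rw [MvPowerSeries.WithPiTopology.summable_iff_summable_coeff]
  refine fun d => summable_of_hasFiniteSupport ((Set.finite_singleton d.support).subset ?_)
  intro s hs
  rw [Function.mem_support, key, MvPowerSeries.coeff_monomial] at hs
  have : d = ∑ i ∈ s, Finsupp.single i 1 := by
    by_contra hne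
    exact hs (if_neg hne)
  rw [Set.mem_singleton_iff, this, hsupp]

theorem multipliable_one_sub_X :
    Multipliable fun i : σ => 1 - (MvPowerSeries.X i : MvPowerSeries σ ℤ) := by
  simpa only [sub_eq_add_neg] using multipliable_one_add_of_summable_prod summable_prod_neg_X

/-- Multiplying by `1 - X a` cancels the coefficient at `d` against the one at `d - a`, which
removes exactly the monomials divisible by `X a`. -/
theorem prod_one_sub_X_mul_sumMonomials [DecidableEq σ] (s : Finset σ) (d : σ →₀ ℕ) :
    MvPowerSeries.coeff d
      ((∏ i ∈ s, (1 - (MvPowerSeries.X i : MvPowerSeries σ ℤ))) * sumMonomials σ) =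
      if Disjoint s d.support then 1 else 0 := by
  induction s using Finset.induction_on generalizing d with
  | empty => simp [sumMonomials, MvPowerSeries.coeff_apply]
  | insert a s ha ih =>
    rw [Finset.prod_insert ha, mul_assoc, sub_mul, one_mul, map_sub, ih, MvPowerSeries.X,
      MvPowerSeries.coeff_monomial_mul]
    by_cases had : d a = 0
    · have : ¬ Finsupp.single a 1 ≤ d := by
        rw [Finsupp.single_le_iff]; omega
      simp [this, had]
    · have hle : Finsupp.single a 1 ≤ d := by
        rw [Finsupp.single_le_iff]; omega
      have hiff : Disjoint s (d - Finsupp.single a 1).support ↔ Disjoint s d.support := by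
        simp only [Finset.disjoint_left, Finsupp.mem_support_iff, Finsupp.tsub_apply]
        refine forall₂_congr fun j hj => ?_
        rw [Finsupp.single_eq_of_ne (by rintro rfl; exact ha hj), Nat.sub_zero]
      rw [if_pos hle, ih]
      simp [had, hiff]

theorem tprod_one_sub_X_mul_sumMonomials :
    (∏' i : σ, (1 - (MvPowerSeries.X i : MvPowerSeries σ ℤ))) * sumMonomials σ = 1 := by
  classical
  refine tendsto_nhds_unique (multipliable_one_sub_X.hasProd.mul_const (sumMonomials σ)) ?_
  rw [MvPowerSeries.WithPiTopology.tendsto_iff_coeff_tendsto]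
  intro d
  refine tendsto_nhds_of_eventually_eq ?_
  -- Once `s` contains the support of `d`, the two are disjoint only for `d = 0`.
  filter_upwards [Filter.eventually_ge_atTop d.support] with s hs
  rw [prod_one_sub_X_mul_sumMonomials, MvPowerSeries.coeff_one]
  refine if_congr ?_ rfl rfl
  rw [← Finsupp.support_eq_empty]
  exact ⟨fun h => Finset.disjoint_self_iff_empty _ |>.1 (h.mono_left hs), fun h => by simp [h]⟩

end Geometric

/-! ### Splitting sums along injections -/

section Sums

variable {σ ι κ : Type*}

theorem tsum_eq_tsum_comp_add {f : ι → MvPowerSeries σ ℤ} (hf : Summable f) {g : κ → ι}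
    (hg : Function.Injective g) :
    ∑' i, f i = ∑' k, f (g k) + ∑' i, (Set.range g)ᶜ.indicator f i := by
  rw [← tsum_range f hg, ← tsum_subtype]
  exact (Summable.tsum_add_tsum_compl (hf.subtype _) (hf.subtype _)).symm

theorem tsum_list [Fintype κ] {f : List κ → MvPowerSeries σ ℤ} (hf : Summable f) :
    ∑' w, f w = f [] + ∑ z, ∑' w, f (z :: w) := by
  have hg : Function.Injective fun p : κ × List κ => p.1 :: p.2 := by
    rintro ⟨a, u⟩ ⟨a', u'⟩ h
    simpa using h
  have hprod : ∑' p : κ × List κ, f (p.1 :: p.2) = ∑ z, ∑' w, f (z :: w) := by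
    rw [← tsum_fintype (L := .unconditional _)]
    exact (hf.comp_injective hg).tsum_prod
  rw [tsum_eq_tsum_comp_add hf hg, hprod, tsum_eq_single [], add_comm]
  · simp
  · intro w hw
    refine Set.indicator_of_notMem (fun h => ?_) _
    cases w with
    | nil => exact hw rfl
    | cons a w => exact h ⟨(a, w), rfl⟩

theorem length_le_order_prod_zipWith {κ' : Type*} {m : κ → κ' → MvPowerSeries σ ℤ}
    (hm : ∀ i j, 1 ≤ (m i j).order) (u : List κ) (v : List κ') (h : u.length = v.length) :
    (u.length : ℕ∞) ≤ (List.zipWith m u v).prod.order := by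
  induction u generalizing v with
  | nil => simp
  | cons x u ih =>
    cases v with
    | nil => simp at h
    | cons y v =>
      rw [List.zipWith_cons_cons, List.prod_cons, List.length_cons, Nat.cast_add, add_comm]
      exact (add_le_add (hm x y) (ih v (by simpa using h))).trans MvPowerSeries.le_order_mul

end Sums

/-! ### Cramer's rule for erasing a row -/

section Cramer

variable {X R : Type*} [Fintype X] [DecidableEq X] [CommRing R]

/-- The hypothesis says `(1 - M) F = v e_x`. Multiply by the adjugate: its `(x, x)` entry replaces
row `x` of `1 - M` by `e_x`, which amounts to erasing row `x` of `M`. -/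
theorem det_one_sub_mul_of_mulVec_eq_single (M : Matrix X X R) (F : X → R) (x : X) (v : R)
    (h : ∀ y, F y = ∑ j, M y j * F j + if y = x then v else 0) :
    (1 - M).det * F x = (1 - M.updateRow x 0).det * v := by
  have h1 : (1 - M).mulVec F = Pi.single x v := by
    ext y
    rw [Matrix.sub_mulVec, Matrix.one_mulVec, Pi.sub_apply, Pi.single_apply, sub_eq_iff_eq_add, h y,
      add_comm]
    rfl
  have h2 : (1 - M).adjugate x x = (1 - M.updateRow x 0).det := by
    rw [Matrix.adjugate_apply]
    congr 1
    ext i j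
    by_cases hi : i = x
    · subst hi
      simp [Matrix.one_apply, Pi.single_apply, eq_comm]
    · simp [hi]
  have h3 := congrFun (congrArg (1 - M).adjugate.mulVec h1) x
  rw [Matrix.mulVec_mulVec, Matrix.adjugate_mul, Matrix.smul_mulVec, Matrix.one_mulVec,
    Matrix.mulVec_single] at h3
  simpa [h2, mul_comm] using h3

end Cramer

/-! ### Cyclic weights as closed walks -/

section Walks

variable {X R : Type*} [CommRing R] (m : X → X → R)

/-- The weight `m(y, v₁) m(v₁, v₂) ⋯ m(vₖ, x)` of a walk from `y` to `x`. -/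
def walkWeight (x : X) : X → List X → R
  | y, [] => m y x
  | y, z :: v => m y z * walkWeight x z v

/-- The weight `m(x₁, x₂) ⋯ m(xₖ, x₁)` of a word read cyclically. -/
def circWeight (w : List X) : R := (List.zipWith m w (w.rotate 1)).prod

theorem prod_zipWith_concat (x y : X) (v : List X) :
    (List.zipWith m (y :: v) (v ++ [x])).prod = walkWeight m x y v := by
  induction v generalizing y with
  | nil => simp [walkWeight]
  | cons z v ih => rw [List.cons_append, List.zipWith_cons_cons, List.prod_cons, ih, walkWeight]

theorem circWeight_cons (x : X) (v : List X) : circWeight m (x :: v) = walkWeight m x x v := by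
  rw [circWeight, ← prod_zipWith_concat]
  simp

theorem walkWeight_append (x y : X) (u v : List X) :
    walkWeight m x y (u ++ x :: v) = walkWeight m x y u * walkWeight m x x v := by
  induction u generalizing y with
  | nil => rfl
  | cons z u ih => rw [List.cons_append, walkWeight, walkWeight, ih, mul_assoc]

/-- Words beginning with `x` are closed walks at `x`; concatenating them concatenates the walks, so
the weights multiply. -/
theorem circWeight_flatten (x : X) (ls : List (List X)) (h : ∀ l ∈ ls, ∃ t, l = x :: t) :
    circWeight m ls.flatten = (ls.map (circWeight m)).prod := by
  induction ls with
  | nil => simp [circWeight]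
  | cons l ls ih =>
    obtain ⟨t, rfl⟩ := h l (by simp)
    rw [List.map_cons, List.prod_cons, ← ih fun l hl => h l (by simp [hl]), List.flatten_cons]
    cases ls with
    | nil => simp [circWeight]
    | cons l' ls =>
      obtain ⟨t', rfl⟩ := h l' (by simp)
      rw [List.flatten_cons, List.cons_append, List.cons_append, circWeight_cons, circWeight_cons,
        circWeight_cons, walkWeight_append]

theorem circWeight_eq_zero {z : X} (hz : ∀ j, m z j = 0) {w : List X} (hw : z ∈ w) :
    circWeight m w = 0 := by
  refine List.prod_eq_zero ?_
  obtain ⟨i, hi, rfl⟩ := List.mem_iff_getElem.1 hw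
  refine List.mem_iff_getElem.2 ⟨i, by simpa using hi, ?_⟩
  rw [List.getElem_zipWith, hz]

theorem circWeight_congr {m m' : X → X → R} {w : List X} (h : ∀ i ∈ w, m i = m' i) :
    circWeight m w = circWeight m' w := by
  have key : ∀ v : List X, List.zipWith m w v = List.zipWith m' w v := by
    induction w with
    | nil => simp
    | cons a w ih =>
      intro v
      cases v with
      | nil => rfl
      | cons c v =>
        rw [List.zipWith_cons_cons, List.zipWith_cons_cons, h a (by simp),
          ih fun i hi => h i (by simp [hi])]
  rw [circWeight, circWeight, key]

variable [LinearOrder X]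

/-- The product of the cyclic weights of the factors of the Lyndon factorization. -/
def decWeight (w : List X) : R := ((lyndonFactorization w).map (circWeight m)).prod

theorem mem_of_mem_lyndonFactorization {w l : List X} (hl : l ∈ lyndonFactorization w) {z : X}
    (hz : z ∈ l) : z ∈ w := by
  rw [← (lyndonFactorization_spec w).2.2]
  exact List.mem_flatten.2 ⟨l, hl, hz⟩

theorem decWeight_eq_zero {z : X} (hz : ∀ j, m z j = 0) {w : List X} (hw : z ∈ w) :
    decWeight m w = 0 := by
  rw [← (lyndonFactorization_spec w).2.2] at hw
  obtain ⟨l, hl, hzl⟩ := List.mem_flatten.1 hw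
  exact List.prod_eq_zero (List.mem_map.2 ⟨l, hl, circWeight_eq_zero m hz hzl⟩)

theorem decWeight_congr {m m' : X → X → R} {w : List X} (h : ∀ i ∈ w, m i = m' i) :
    decWeight m w = decWeight m' w := by
  rw [decWeight, decWeight]
  congr 1
  refine List.map_congr_left fun l hl => circWeight_congr fun i hi => h i ?_
  exact mem_of_mem_lyndonFactorization hl hi

theorem lyndonFactorization_nil : lyndonFactorization ([] : List X) = [] :=
  lyndonFactorization_unique (lyndonFactorization_spec _) ⟨by simp, by simp, rfl⟩

/-- If `x` is the smallest letter of `x :: v`, all Lyndon factors of `x :: v` begin with `x`. -/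
theorem IsLyndonFactorization.exists_eq_cons {x : X} {v : List X} {ls : List (List X)}
    (h : IsLyndonFactorization (x :: v) ls) (hv : ∀ a ∈ v, x ≤ a) :
    ∀ l ∈ ls, ∃ t, l = x :: t := by
  obtain ⟨hL, hsort, hflat⟩ := h
  cases ls with
  | nil => simp
  | cons l₁ ls =>
    obtain ⟨a, t, rfl⟩ := List.exists_cons_of_ne_nil (hL l₁ (by simp)).1
    rw [List.flatten_cons, List.cons_append] at hflat
    obtain ⟨rfl, htail⟩ := List.cons.inj hflat
    intro l hl
    rcases List.mem_cons.1 hl with rfl | hl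
    · exact ⟨t, rfl⟩
    · obtain ⟨c, t', rfl⟩ := List.exists_cons_of_ne_nil (hL l (by simp [hl])).1
      -- A later factor is at most the first one, so its first letter cannot exceed the minimal
      -- letter `a`.
      have hle : c :: t' ≤ a :: t := (List.pairwise_cons.1 hsort).1 _ hl
      have hc : a ≤ c := hv c <| by
        rw [← htail]
        exact List.mem_append_right _ (List.mem_flatten.2 ⟨_, hl, by simp⟩)
      rcases hc.lt_or_eq with hlt | rfl
      · exact absurd (List.cons_lt_cons_iff.2 (Or.inl hlt)) (not_lt.2 hle)
      · exact ⟨t', rfl⟩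

/-- The factors of `u` start with letters above `x`, those of `x :: v` with `x`, so the two
factorizations concatenate to a nonincreasing one. The factors of the second are closed walks at
`x`, whose weights recombine into a single cyclic weight. -/
theorem decWeight_append_cons {x : X} {u v : List X} (hu : ∀ a ∈ u, x < a)
    (hv : ∀ a ∈ v, x ≤ a) :
    decWeight m (u ++ x :: v) = decWeight m u * circWeight m (x :: v) := by
  have hU := lyndonFactorization_spec u
  have hV := lyndonFactorization_spec (x :: v)
  have hhead := hV.exists_eq_cons hv
  have hfact : IsLyndonFactorization (u ++ x :: v)
      (lyndonFactorization u ++ lyndonFactorization (x :: v)) := by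
    refine ⟨fun l hl => ?_, ?_, by rw [List.flatten_append, hU.2.2, hV.2.2]⟩
    · rcases List.mem_append.1 hl with hl | hl
      exacts [hU.1 l hl, hV.1 l hl]
    · refine List.pairwise_append.2 ⟨hU.2.1, hV.2.1, fun l hl l' hl' => ?_⟩
      obtain ⟨t', rfl⟩ := hhead l' hl'
      obtain ⟨c, t, rfl⟩ := List.exists_cons_of_ne_nil (hU.1 l hl).1
      have hc : x < c := hu c (mem_of_mem_lyndonFactorization hl (by simp))
      exact (List.cons_lt_cons_iff.2 (Or.inl hc)).le
  rw [decWeight, lyndonFactorization_unique (lyndonFactorization_spec _) hfact, List.map_append,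
    List.prod_append, ← circWeight_flatten m x _ hhead, hV.2.2, decWeight]

end Walks

/-! ### The sum over Lyndon factorizations -/

section Dec

variable {X : Type*}

theorem length_le_order_circWeight {m : X → X → BSeries X} (hm : ∀ i j, 1 ≤ (m i j).order)
    (w : List X) : (w.length : ℕ∞) ≤ (circWeight m w).order :=
  length_le_order_prod_zipWith hm _ _ (by simp)

theorem length_le_order_walkWeight {m : X → X → BSeries X} (hm : ∀ i j, 1 ≤ (m i j).order)
    (x y : X) (w : List X) : (w.length : ℕ∞) ≤ (walkWeight m x y w).order := by
  rw [← prod_zipWith_concat]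
  refine le_trans ?_ (length_le_order_prod_zipWith hm (y :: w) (w ++ [x]) (by simp))
  simp

theorem length_le_order_decWeight [LinearOrder X] {m : X → X → BSeries X}
    (hm : ∀ i j, 1 ≤ (m i j).order) (w : List X) :
    (w.length : ℕ∞) ≤ (decWeight m w).order := by
  conv_lhs => rw [← (lyndonFactorization_spec w).2.2]
  rw [decWeight]
  induction lyndonFactorization w with
  | nil => simp
  | cons l ls ih =>
    rw [List.flatten_cons, List.length_append, List.map_cons, List.prod_cons, Nat.cast_add]
    exact (add_le_add (length_le_order_circWeight hm l) ih).trans MvPowerSeries.le_order_mul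

/-- The matrix `b` with the rows outside `S` replaced by zero. -/
def rowRestrict [DecidableEq X] (S : Finset X) (i j : X) : BSeries X := if i ∈ S then b i j else 0

theorem one_le_order_rowRestrict [DecidableEq X] (S : Finset X) (i j : X) :
    1 ≤ (rowRestrict S i j).order := by
  rw [MvPowerSeries.one_le_order_iff_constCoeff_eq_zero, rowRestrict]
  split_ifs <;> simp [b]

theorem updateRow_rowRestrict [DecidableEq X] {S : Finset X} {x : X} (hx : x ∉ S) :
    (Matrix.of (rowRestrict (insert x S))).updateRow x 0 = Matrix.of (rowRestrict S) := by
  ext1 i j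
  by_cases hi : i = x
  · subst hi
    simp [rowRestrict, hx]
  · simp [rowRestrict, hi]

theorem rowRestrict_univ [Fintype X] [DecidableEq X] :
    rowRestrict (Finset.univ : Finset X) = b := by
  ext1 i
  ext1 j
  simp [rowRestrict]

variable [Fintype X]

theorem summable_walkWeight {m : X → X → BSeries X} (hm : ∀ i j, 1 ≤ (m i j).order) (x y : X) :
    Summable (walkWeight m x y) :=
  summable_of_le_order List.length (List.finite_length_le X) (length_le_order_walkWeight hm x y)

theorem det_one_sub_mul_one_add_tsum_walkWeight [DecidableEq X] {m : X → X → BSeries X}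
    (hm : ∀ i j, 1 ≤ (m i j).order) (x : X) :
    (1 - Matrix.of m).det * (1 + ∑' w, walkWeight m x x w) =
      (1 - (Matrix.of m).updateRow x 0).det := by
  have hs := summable_walkWeight hm x
  have key := det_one_sub_mul_of_mulVec_eq_single (Matrix.of m)
    (fun y => (if y = x then 1 else 0) + ∑' w, walkWeight m x y w) x 1 fun y => by
      -- The walk with no intermediate letter has weight `m y x`; it matches the Kronecker delta
      -- term of `F` after multiplication by `m`.
      rw [tsum_list (hs y), add_comm]
      congr 1
      simp only [walkWeight, (hs _).tsum_mul_left, mul_add, Finset.sum_add_distrib]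
      simp
  simpa using key

variable [LinearOrder X]

theorem summable_decWeight {m : X → X → BSeries X} (hm : ∀ i j, 1 ≤ (m i j).order) :
    Summable (decWeight m) :=
  summable_of_le_order List.length (List.finite_length_le X) (length_le_order_decWeight hm)

/-- Words without `x` contribute the old sum. A word with `x` is cut at its first `x`, giving an
independent choice of a prefix avoiding `x` and a closed walk at `x`. -/
theorem tsum_decWeight_insert {S : Finset X} {x : X} (hx : ∀ a ∈ S, x < a) :
    ∑' w, decWeight (rowRestrict (insert x S)) w =
      (∑' w, decWeight (rowRestrict S) w) *
        (1 + ∑' w, walkWeight (rowRestrict (insert x S)) x x w) := by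
  have hxS : x ∉ S := fun h => (hx x h).false
  set m := rowRestrict S
  set m' := rowRestrict (insert x S)
  have hm : ∀ i j, 1 ≤ (m i j).order := one_le_order_rowRestrict S
  have hm' : ∀ i j, 1 ≤ (m' i j).order := one_le_order_rowRestrict _
  have hzero {z : X} (hz : z ∉ S) (j : X) : m z j = 0 := by simp [m, rowRestrict, hz]
  have hzero' {z : X} (hz : z ∉ insert x S) (j : X) : m' z j = 0 := by
    simp only [m', rowRestrict, if_neg hz]
  have hmm {z : X} (hz : z ≠ x) : m' z = m z := by
    ext1 j
    simp [m, m', rowRestrict, hz]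
  let g : {u : List X // x ∉ u} × List X → List X := fun p => p.1.1 ++ x :: p.2
  have hg : Function.Injective g := by
    rintro ⟨⟨u, hu⟩, v⟩ ⟨⟨u', hu'⟩, v'⟩ h
    have h' : u ++ x :: v = u' ++ x :: v' := h
    have hlen : u.length = u'.length := by
      -- As `x` is not in the prefix, the prefix length is the index of the first `x`.
      simpa [hu, hu', List.idxOf_append] using congrArg (List.idxOf x) h'
    obtain ⟨rfl, h2⟩ := List.append_inj h' hlen
    simpa using h2
  have hterm (p : {u : List X // x ∉ u} × List X) :
      decWeight m' (g p) = decWeight m p.1.1 * walkWeight m' x x p.2 := by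
    obtain ⟨⟨u, hu⟩, v⟩ := p
    change decWeight m' (u ++ x :: v) = decWeight m u * walkWeight m' x x v
    rw [← circWeight_cons]
    -- A letter outside `insert x S` has a zero row and kills both sides; otherwise `x` is minimal
    -- and the factorization splits.
    by_cases huS : ∀ a ∈ u, a ∈ S
    · by_cases hvS : ∀ a ∈ v, a ∈ insert x S
      · have hv : ∀ a ∈ v, x ≤ a := fun a ha => by
          rcases Finset.mem_insert.1 (hvS a ha) with rfl | h
          exacts [le_rfl, (hx a h).le]
        rw [decWeight_append_cons m' (fun a ha => hx a (huS a ha)) hv,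
          decWeight_congr fun i hi => hmm (by rintro rfl; exact hu hi)]
      · push Not at hvS
        obtain ⟨z, hzv, hz⟩ := hvS
        rw [decWeight_eq_zero m' (hzero' hz) (by simp [hzv]),
          circWeight_eq_zero m' (hzero' hz) (by simp [hzv]), mul_zero]
    · push Not at huS
      obtain ⟨z, hzu, hz⟩ := huS
      have hz' : z ∉ insert x S := by
        rw [Finset.mem_insert]
        rintro (rfl | h)
        exacts [hu hzu, hz h]
      rw [decWeight_eq_zero m' (hzero' hz') (by simp [hzu]),
        decWeight_eq_zero m (hzero hz) hzu, zero_mul]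
  have hdec : ∑' u : {u : List X // x ∉ u}, decWeight m u.1 = ∑' w, decWeight m w := by
    refine Function.Injective.tsum_eq Subtype.val_injective fun w hw => ?_
    exact ⟨⟨w, fun hxw => hw (decWeight_eq_zero m (hzero hxS) hxw)⟩, rfl⟩
  have hrest (w : List X) : (Set.range g)ᶜ.indicator (decWeight m') w = decWeight m w := by
    by_cases hxw : x ∈ w
    · obtain ⟨u, v, rfl, hu⟩ := List.eq_append_cons_of_mem hxw
      rw [decWeight_eq_zero m (hzero hxS) hxw]
      have hmem : u ++ x :: v ∈ Set.range g := ⟨(⟨u, hu⟩, v), rfl⟩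
      exact Set.indicator_of_notMem (Set.notMem_compl_iff.2 hmem) _
    · rw [Set.indicator_of_mem]
      · exact decWeight_congr fun i hi => hmm (by rintro rfl; exact hxw hi)
      · rintro ⟨p, rfl⟩
        simp [g] at hxw
  rw [tsum_eq_tsum_comp_add (summable_decWeight hm') hg, tsum_congr hterm, tsum_congr hrest,
    mul_add, mul_one, add_comm]
  congr 1
  rw [← hdec]
  refine (Summable.tsum_mul_tsum ((summable_decWeight hm).subtype _)
    (summable_walkWeight hm' x x) ?_).symm
  exact ((summable_decWeight hm').comp_injective hg).congr hterm

/-- Letters are added in decreasing order, so that each new one is minimal; the closed-walk factor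
gained by the sum is exactly what turns the new determinant into the old one. -/
theorem det_mul_tsum_decWeight (S : Finset X) :
    (1 - Matrix.of (rowRestrict S)).det * ∑' w, decWeight (rowRestrict S) w = 1 := by
  induction S using Finset.induction_on_min with
  | empty =>
    have h0 : Matrix.of (rowRestrict (∅ : Finset X)) = 0 := by
      ext1 i j
      simp [rowRestrict]
    rw [h0, sub_zero, Matrix.det_one, one_mul, tsum_eq_single []]
    · simp [decWeight, lyndonFactorization_nil]
    · intro w hw
      obtain ⟨a, w, rfl⟩ := List.exists_cons_of_ne_nil hw
      exact decWeight_eq_zero _ (z := a) (by simp [rowRestrict]) (by simp)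
  | insert x S hx ih =>
    rw [tsum_decWeight_insert hx, mul_left_comm,
      det_one_sub_mul_one_add_tsum_walkWeight (one_le_order_rowRestrict _),
      updateRow_rowRestrict fun h => (hx x h).false, mul_comm, ih]

end Dec

/-! ### MacMahon's master theorem -/

section Vert

variable {X : Type*} [Fintype X] [DecidableEq X]

/-- The coefficient of the monomial `γ` in the product of the linear forms `∑ j, m(i, j) X_j`
over `i ∈ s`. -/
def formCoeff (m : X → X → BSeries X) (s γ : Multiset X) : BSeries X :=
  MvPolynomial.coeff (Multiset.toFinsupp γ)
    (s.map fun i => ∑ j, MvPolynomial.C (m i j) * MvPolynomial.X j).prod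

theorem formCoeff_zero (m : X → X → BSeries X) (γ : Multiset X) :
    formCoeff m 0 γ = if γ = 0 then 1 else 0 := by
  rw [formCoeff, Multiset.map_zero, Multiset.prod_zero, MvPolynomial.coeff_one]
  refine if_congr ?_ rfl rfl
  rw [eq_comm, map_eq_zero_iff _ (Multiset.toFinsupp (α := X)).injective]

/-- Choose the term `m y j * X_j` from the linear form of one copy of `y`. -/
theorem formCoeff_cons (m : X → X → BSeries X) (y : X) (s γ : Multiset X) :
    formCoeff m (y ::ₘ s) γ = ∑ j, if j ∈ γ then m y j * formCoeff m s (γ.erase j) else 0 := by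
  rw [formCoeff, Multiset.map_cons, Multiset.prod_cons, Finset.sum_mul, MvPolynomial.coeff_sum]
  refine Finset.sum_congr rfl fun j _ => ?_
  rw [mul_assoc, MvPolynomial.coeff_C_mul, MvPolynomial.coeff_X_mul', mul_ite, mul_zero]
  refine if_congr (by simp) ?_ rfl
  rw [formCoeff]
  congr 2
  ext a
  by_cases ha : a = j
  · subst ha; simp
  · simp [ha]

theorem card_le_order_formCoeff {m : X → X → BSeries X} (hm : ∀ i j, 1 ≤ (m i j).order)
    (s γ : Multiset X) : (s.card : ℕ∞) ≤ (formCoeff m s γ).order := by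
  induction s using Multiset.induction generalizing γ with
  | empty => simp
  | cons y s ih =>
    rw [formCoeff_cons]
    refine le_order_sum _ _ fun j _ => ?_
    split_ifs
    · rw [Multiset.card_cons, Nat.cast_add, add_comm]
      exact (add_le_add (hm y j) (ih _)).trans MvPowerSeries.le_order_mul
    · simp

theorem formCoeff_eq_zero {m : X → X → BSeries X} {x : X} (hx : ∀ j, m x j = 0)
    {s : Multiset X} (hs : x ∈ s) (γ : Multiset X) : formCoeff m s γ = 0 := by
  obtain ⟨s, rfl⟩ := Multiset.exists_cons_of_mem hs
  rw [formCoeff_cons]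
  simp [hx]

theorem formCoeff_congr {m m' : X → X → BSeries X} {s : Multiset X} (h : ∀ i ∈ s, m i = m' i)
    (γ : Multiset X) : formCoeff m s γ = formCoeff m' s γ := by
  rw [formCoeff, formCoeff]
  congr 2
  exact Multiset.map_congr rfl fun i hi => by rw [h i hi]

/-- A transfer-matrix form of MacMahon's master theorem: erasing one row. -/
theorem det_mul_tsum_formCoeff {m : X → X → BSeries X} (hm : ∀ i j, 1 ≤ (m i j).order) (x : X)
    {m₀ : X → X → BSeries X} (h₀ : ∀ j, m₀ x j = 0) (h₁ : ∀ i, i ≠ x → m i = m₀ i) :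
    (1 - Matrix.of m).det * ∑' s, formCoeff m s s =
      (1 - (Matrix.of m).updateRow x 0).det * ∑' s, formCoeff m₀ s s := by
  -- Off-diagonal coefficients: source content `s`, target content `s + x - y`. At `y = x` this is
  -- the diagonal coefficient, and the sums over `s` form the vector to which Cramer's rule applies.
  let G : X → Multiset X → BSeries X := fun y s =>
    if y ∈ x ::ₘ s then formCoeff m s ((x ::ₘ s).erase y) else 0
  have hG (y : X) : Summable (G y) := by
    refine summable_of_le_order Multiset.card finite_setOf_card_le fun s => ?_
    simp only [G]
    split_ifs
    exacts [card_le_order_formCoeff hm _ _, by simp]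
  -- Expanding one linear form of `y` leaves source `s` and target `s + x - j`.
  have hcons (y : X) (s : Multiset X) : G y (y ::ₘ s) = ∑ j, m y j * G j s := by
    have hmem : y ∈ x ::ₘ y ::ₘ s := by simp
    simp only [G, if_pos hmem]
    rw [Multiset.cons_swap, Multiset.erase_cons_head, formCoeff_cons]
    exact Finset.sum_congr rfl fun j _ => by rw [mul_ite, mul_zero]
  -- If `y` is not in `s`, the target `s + x - y` exists only for `y = x`; then `s` avoids `x`, so
  -- row `x` may be taken to be zero.
  have hrest (y : X) (s : Multiset X) :
      (Set.range (Multiset.cons y))ᶜ.indicator (G y) s =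
        if y = x then formCoeff m₀ s s else 0 := by
    by_cases hy : y ∈ s
    · obtain ⟨t, rfl⟩ := Multiset.exists_cons_of_mem hy
      have hmem : y ::ₘ t ∈ Set.range (Multiset.cons y) := ⟨t, rfl⟩
      rw [Set.indicator_of_notMem (Set.notMem_compl_iff.2 hmem)]
      split_ifs with h
      · exact (formCoeff_eq_zero (h ▸ h₀) hy _).symm
      · rfl
    · rw [Set.indicator_of_mem (by rintro ⟨t, rfl⟩; simp at hy)]
      simp only [G, Multiset.mem_cons, hy, or_false]
      refine if_ctx_congr Iff.rfl (fun h => ?_) fun _ => rfl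
      subst h
      rw [Multiset.erase_cons_head]
      exact formCoeff_congr (fun i hi => h₁ i (by rintro rfl; exact hy hi)) s
  have key := det_one_sub_mul_of_mulVec_eq_single (Matrix.of m) (fun y => ∑' s, G y s) x
    (∑' s, formCoeff m₀ s s) fun y => by
      rw [tsum_eq_tsum_comp_add (hG y) (g := Multiset.cons y)
          fun _ _ => (Multiset.cons_inj_right y).1,
        tsum_congr (hcons y), tsum_congr (hrest y)]
      congr 1
      · rw [Summable.tsum_finsetSum fun j _ => (hG j).mul_left _]
        exact Finset.sum_congr rfl fun j _ => (hG j).tsum_mul_left _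
      · split_ifs <;> simp
  rw [← key]
  congr 1
  refine tsum_congr fun s => ?_
  simp [G]

theorem det_mul_tsum_formCoeff_rowRestrict (S : Finset X) :
    (1 - Matrix.of (rowRestrict S)).det * ∑' s, formCoeff (rowRestrict S) s s = 1 := by
  induction S using Finset.induction_on with
  | empty =>
    have h0 : Matrix.of (rowRestrict (∅ : Finset X)) = 0 := by
      ext1 i j
      simp [rowRestrict]
    rw [h0, sub_zero, Matrix.det_one, one_mul, tsum_eq_single 0]
    · simp [formCoeff_zero]
    · intro s hs
      obtain ⟨a, ha⟩ := Multiset.exists_mem_of_ne_zero hs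
      exact formCoeff_eq_zero (by simp [rowRestrict]) ha _
  | insert x S hx ih =>
    rw [det_mul_tsum_formCoeff (one_le_order_rowRestrict _) x (m₀ := rowRestrict S)
      (by simp [rowRestrict, hx]) (fun i hi => by ext1 j; simp [rowRestrict, hi]),
      updateRow_rowRestrict hx, ih]

/-- Expanding the product chooses one letter per linear form, hence a word of content `γ`. The
length condition is needed because `List.zipWith` truncates. -/
theorem formCoeff_coe_eq_tsum (m : X → X → BSeries X) (s : List X) (γ : Multiset X) :
    formCoeff m s γ = ∑' w : List X,
      if (w : Multiset X) = γ ∧ w.length = s.length then (List.zipWith m s w).prod else 0 := by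
  have hsum (s : List X) (γ : Multiset X) : Summable fun w : List X =>
      if (w : Multiset X) = γ ∧ w.length = s.length then (List.zipWith m s w).prod else 0 := by
    refine summable_of_hasFiniteSupport ((List.finite_length_eq X s.length).subset fun w hw => ?_)
    by_contra hcon
    exact hw (if_neg fun h => hcon h.2)
  induction s generalizing γ with
  | nil =>
    rw [Multiset.coe_nil, formCoeff_zero, tsum_eq_single []]
    · simp [eq_comm]
    · intro w hw
      exact if_neg fun h => hw (List.length_eq_zero_iff.1 h.2)
  | cons y s ih =>
    rw [← Multiset.cons_coe, formCoeff_cons, tsum_list (hsum _ _), if_neg (by simp), zero_add]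
    refine Finset.sum_congr rfl fun j _ => ?_
    have hiff (w : List X) : ((j :: w : List X) : Multiset X) = γ ↔
        j ∈ γ ∧ (w : Multiset X) = γ.erase j := by
      rw [← Multiset.cons_coe]
      constructor
      · rintro rfl
        simp
      · rintro ⟨h1, h2⟩
        rw [h2, Multiset.cons_erase h1]
    split_ifs with hj
    · rw [ih, ← (hsum s (γ.erase j)).tsum_mul_left]
      refine tsum_congr fun w => ?_
      simp [hiff, hj]
    · simp [hiff, hj]

end Vert

/-! ### Vertical weights grouped by content -/

section VertWords

variable {X : Type*} [Fintype X] [LinearOrder X]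

theorem one_le_order_b (i j : X) : 1 ≤ (b i j).order := by
  rw [← rowRestrict_univ]
  exact one_le_order_rowRestrict _ i j

theorem summable_betaVert : Summable (betaVert : List X → BSeries X) := by
  refine summable_of_le_order List.length (List.finite_length_le X) fun w => ?_
  simpa [betaVert] using
    length_le_order_prod_zipWith one_le_order_b (w.insertionSort (· ≤ ·)) w (by simp)

/-- Words of content `s` share the same sorted rearrangement, so the sum over each fibre is the
expansion of one diagonal coefficient. -/
theorem tsum_betaVert_eq_tsum_formCoeff :
    ∑' w : List X, betaVert w = ∑' s : Multiset X, formCoeff b s s := by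
  rw [← (summable_betaVert.hasSum.tsum_fiberwise fun w : List X => (w : Multiset X)).tsum_eq]
  refine tsum_congr fun s => ?_
  set t := s.toList.insertionSort (· ≤ ·)
  have ht : (t : Multiset X) = s := by
    rw [Multiset.coe_eq_coe.2 (List.perm_insertionSort _ _), Multiset.coe_toList]
  conv_rhs => rw [← ht, formCoeff_coe_eq_tsum]
  rw [tsum_subtype]
  refine tsum_congr fun w => ?_
  by_cases hw : (w : Multiset X) = s
  · have hperm : w.Perm t := Multiset.coe_eq_coe.1 (hw.trans ht.symm)
    rw [Set.indicator_of_mem (by exact hw), if_pos ⟨hw.trans ht.symm, hperm.length_eq⟩, betaVert]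
    congr 2
    exact ((List.perm_insertionSort _ w).trans hperm).eq_of_pairwise
      (fun _ _ _ _ => le_antisymm) (List.pairwise_insertionSort _ _)
      (List.pairwise_insertionSort _ _)
  · rw [Set.indicator_of_notMem (by exact hw), if_neg fun h => hw (h.1.trans ht)]

end VertWords

/-! ### Words as monomials in Lyndon words -/

section Beta

variable {X : Type*} [LinearOrder X]

/-- The exponent vector recording the multiplicities of the Lyndon factors of a word. -/
def factorCount (w : List X) : {l : List X // IsLyndon l} →₀ ℕ :=
  Multiset.toFinsupp
    ((lyndonFactorization w).attachWith IsLyndon (lyndonFactorization_spec w).1 :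
      Multiset {l : List X // IsLyndon l})

/-- A multiset of Lyndon words has exactly one nonincreasing arrangement, and by uniqueness that
list is the factorization of its concatenation. -/
theorem factorCount_bijective : Function.Bijective (factorCount (X := X)) := by
  constructor
  · intro w w' h
    have h1 := Multiset.coe_eq_coe.1
      ((Multiset.toFinsupp (α := {l : List X // IsLyndon l})).injective h)
    have h2 := h1.map Subtype.val
    rw [List.attachWith_map_subtype_val, List.attachWith_map_subtype_val] at h2
    have h3 : lyndonFactorization w = lyndonFactorization w' :=
      h2.eq_of_pairwise (fun _ _ _ _ h h' => le_antisymm h' h) (lyndonFactorization_spec w).2.1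
        (lyndonFactorization_spec w').2.1
    rw [← (lyndonFactorization_spec w).2.2, h3, (lyndonFactorization_spec w').2.2]
  · intro d
    let ls := (Finsupp.toMultiset d).toList.insertionSort (· ≥ ·)
    have hfact : IsLyndonFactorization (ls.map Subtype.val).flatten (ls.map Subtype.val) := by
      refine ⟨fun l hl => ?_, ?_, rfl⟩
      · obtain ⟨l, -, rfl⟩ := List.mem_map.1 hl
        exact l.2
      · exact List.pairwise_map.2 (List.pairwise_insertionSort _ _)
    have heq := lyndonFactorization_unique (lyndonFactorization_spec _) hfact
    refine ⟨(ls.map Subtype.val).flatten, ?_⟩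
    rw [factorCount, ← AddEquiv.eq_symm_apply]
    change _ = Finsupp.toMultiset d
    rw [← Multiset.coe_toList (Finsupp.toMultiset d), Multiset.coe_eq_coe]
    refine List.Perm.trans (List.Perm.of_eq ?_) (List.perm_insertionSort (· ≥ ·) _)
    refine List.map_injective_iff.2 Subtype.val_injective ?_
    rw [List.attachWith_map_subtype_val, heq]

variable [Finite X]

theorem beta_monomial_factorCount (w : List X) :
    beta X (MvPowerSeries.monomial (factorCount w) 1) = betaDec w := by
  have key (ls : List {l : List X // IsLyndon l}) :
      beta X (MvPowerSeries.monomial (Multiset.toFinsupp (ls : Multiset _)) 1) =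
        (ls.map fun l => betaCirc l.1).prod := by
    induction ls with
    | nil => simp
    | cons l ls ih =>
      rw [← Multiset.cons_coe, ← Multiset.singleton_add, map_add, Multiset.toFinsupp_singleton,
        ← one_mul (1 : ℤ), ← MvPowerSeries.monomial_mul_monomial, map_mul, ih, List.map_cons,
        List.prod_cons, ← beta_lyndonVar]
      rfl
  rw [factorCount, key, betaDec]
  congr 1
  exact List.attachWith_map_val _

theorem hasSum_betaDec :
    HasSum (fun w : List X => betaDec w) (beta X (sumMonomials {l : List X // IsLyndon l})) := by
  have h := (hasSum_monomial_sumMonomials (σ := {l : List X // IsLyndon l})).map (beta X)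
    continuous_beta
  rw [← (Equiv.ofBijective _ factorCount_bijective).hasSum_iff] at h
  exact h.congr_fun fun w => (beta_monomial_factorCount w).symm

end Beta

end Lyndon

end

/-! ### The main theorem -/

theorem theorem1p1 (X : Type*) [Fintype X] [LinearOrder X] :
    -- the infinite product, the inverses and the infinite sums are well defined
    Multipliable (fun l : {l : List X // Lyndon.IsLyndon l} => 1 - Lyndon.lyndonVar l) ∧
    IsUnit (Lyndon.Lam X) ∧
    IsUnit (1 - Matrix.of (Lyndon.b (X := X))).det ∧
    Summable (fun w : List X => Lyndon.betaDec w) ∧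
    Summable (fun w : List X => Lyndon.betaVert w) ∧
    -- the four identities
    Lyndon.beta X (Ring.inverse (Lyndon.Lam X)) = ∑' w : List X, Lyndon.betaDec w ∧
    ∑' w : List X, Lyndon.betaDec w = ∑' w : List X, Lyndon.betaVert w ∧
    ∑' w : List X, Lyndon.betaVert w = Ring.inverse (1 - Matrix.of (Lyndon.b (X := X))).det ∧
    Lyndon.beta X (Lyndon.Lam X) = (1 - Matrix.of (Lyndon.b (X := X))).det ∧
    -- the last identity as a convergent product equal to a polynomial
    HasProd (fun l : {l : List X // Lyndon.IsLyndon l} => 1 - Lyndon.betaCirc l.1)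
      (((1 - Matrix.mvPolynomialX X X ℤ).det : MvPolynomial (X × X) ℤ) :
        MvPowerSeries (X × X) ℤ) := by
  have hmul : Multipliable fun l : {l : List X // Lyndon.IsLyndon l} => 1 - Lyndon.lyndonVar l :=
    Lyndon.multipliable_one_sub_X
  have hLam : Lyndon.Lam X * Lyndon.sumMonomials _ = 1 := Lyndon.tprod_one_sub_X_mul_sumMonomials
  have hdec : (1 - Matrix.of (Lyndon.b (X := X))).det * ∑' w : List X, Lyndon.betaDec w = 1 := by
    -- With all rows switched on, `decWeight b` is `betaDec` by definition.
    have := Lyndon.det_mul_tsum_decWeight (Finset.univ : Finset X)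
    rwa [Lyndon.rowRestrict_univ] at this
  have hvert : (1 - Matrix.of (Lyndon.b (X := X))).det * ∑' w : List X, Lyndon.betaVert w = 1 := by
    have := Lyndon.det_mul_tsum_formCoeff_rowRestrict (Finset.univ : Finset X)
    rwa [Lyndon.rowRestrict_univ, ← Lyndon.tsum_betaVert_eq_tsum_formCoeff] at this
  have hsum := Lyndon.hasSum_betaDec (X := X)
  have hbeta : Lyndon.beta X (Lyndon.Lam X) * ∑' w : List X, Lyndon.betaDec w = 1 := by
    rw [hsum.tsum_eq, ← map_mul, hLam, map_one]
  have hLamInv : Ring.inverse (Lyndon.Lam X) = Lyndon.sumMonomials _ :=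
    left_inv_eq_right_inv (Ring.inverse_mul_cancel _ (IsUnit.of_mul_eq_one _ hLam)) hLam
  have hdet : Lyndon.beta X (Lyndon.Lam X) = (1 - Matrix.of (Lyndon.b (X := X))).det :=
    left_inv_eq_right_inv hbeta (by rw [mul_comm, hdec])
  refine ⟨hmul, IsUnit.of_mul_eq_one _ hLam, IsUnit.of_mul_eq_one _ hdec, hsum.summable,
    Lyndon.summable_betaVert, ?_, ?_, ?_, hdet, ?_⟩
  · rw [hLamInv, hsum.tsum_eq]
  · exact left_inv_eq_right_inv (by rw [mul_comm, hdec]) hvert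
  · exact (left_inv_eq_right_inv
      (Ring.inverse_mul_cancel _ (IsUnit.of_mul_eq_one _ hvert)) hvert).symm
  · have hcoe : (((1 - Matrix.mvPolynomialX X X ℤ).det : MvPolynomial (X × X) ℤ) :
        MvPowerSeries (X × X) ℤ) = (1 - Matrix.of (Lyndon.b (X := X))).det := by
      rw [← MvPolynomial.coeToMvPowerSeries.ringHom_apply, RingHom.map_det]
      congr 1
      ext1 i j
      rw [RingHom.mapMatrix_apply, Matrix.map_apply, Matrix.sub_apply, map_sub,
        Matrix.mvPolynomialX_apply, Matrix.one_apply,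
        apply_ite MvPolynomial.coeToMvPowerSeries.ringHom]
      simp [Matrix.one_apply, Lyndon.b]
    rw [hcoe, ← hdet]
    -- Continuity carries the convergent product `Λ` to the product of the `1 - betaCirc l`.
    have := hmul.hasProd.map (Lyndon.beta X) Lyndon.continuous_beta
    refine this.congr_fun fun l => ?_
    simp [Lyndon.beta_lyndonVar]
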